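/- Let $G$ be a profinite group (a compact, totally disconnected, Hausdorff topological group) whose topology is given by a bi-invariant metric $d$. Let $\Omega$ be a standard Borel space equipped with a non-atomic probability measure $\mu$. Let $L(\Omega,G)$ be the set of Borel maps $\Omega\to G$ modulo equality $\mu$-almost everywhere, with the metric $d(f_1,f_2)=\int_\Omega d(f_1(t),f_2(t))\,d\mu(t)$. Let $G$ act on it by $(g\cdot f)(t)=g\,f(t)$, and let $L(\Omega,G)/G$ be the orbit space with the quotient topology, which is the topology of the metric $d(\bar f_1,\bar f_2)=\inf\{d(f_1',f_2') : f_1'\in \bar f_1,\ f_2'\in\bar f_2\}$. Then $L(\Omega,G)/G$ is a weak $K(G,1)$: it is path connected, for every base point $x$ its fundamental group $\pi_1(L(\Omega,G)/G,x)$ is isomorphic to $G$ as an abstract group, and $\pi_n(L(\Omega,G)/G,x)$ is trivial for all $n\ge 2$ and all $x$. -/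

import Mathlib

open MeasureTheory
open scoped Topology

noncomputable section

namespace RandomVariables

/-- The space `L(Ω, E)` of measurable maps from the probability space `(Ω, μ)` to the bounded
metric space `E`, modulo equality almost everywhere. Mathlib's `Ω →ₘ[μ] E` consists of the
classes of almost everywhere strongly measurable maps; these are the same as the classes of Borel
maps when `E` is separable, in particular when `E` is compact. -/
abbrev LSpace {Ω : Type*} [MeasurableSpace Ω] (μ : Measure Ω) (E : Type*) [TopologicalSpace E] :
    Type _ :=
  Ω →ₘ[μ] E

section Metric

variable {Ω : Type*} [MeasurableSpace Ω] {μ : Measure Ω} [IsFiniteMeasure μ]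
  {E : Type*} [MetricSpace E] [BoundedSpace E]

theorem integrable_dist (f g : LSpace μ E) : Integrable (fun t => dist (f t) (g t)) μ := by
  refine Integrable.of_bound (f.aestronglyMeasurable.dist g.aestronglyMeasurable)
    (Metric.diam (Set.univ : Set E)) (Filter.Eventually.of_forall fun t => ?_)
  rw [Real.norm_of_nonneg dist_nonneg]
  exact Metric.dist_le_diam_of_mem (Bornology.IsBounded.all _) (Set.mem_univ _) (Set.mem_univ _)

/-- The metric `d(f, g) = ∫ d(f(t), g(t)) dt` on `L(Ω, E)`. -/
instance LSpace.instMetricSpace : MetricSpace (LSpace μ E) where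
  dist f g := ∫ t, dist (f t) (g t) ∂μ
  dist_self f := by simp
  dist_comm f g := by simp only [dist_comm]
  dist_triangle f g h := by
    rw [← integral_add (integrable_dist f g) (integrable_dist g h)]
    exact integral_mono (integrable_dist f h) ((integrable_dist f g).add (integrable_dist g h))
      fun t => dist_triangle _ _ _
  eq_of_dist_eq_zero {f g} h := by
    refine AEEqFun.ext ?_
    have := (integral_eq_zero_iff_of_nonneg (fun t => dist_nonneg) (integrable_dist f g)).1 h
    filter_upwards [this] with t ht
    exact dist_eq_zero.1 ht

theorem LSpace.dist_def (f g : LSpace μ E) : dist f g = ∫ t, dist (f t) (g t) ∂μ := rfl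

end Metric

section Orbits

variable {Ω : Type*} [MeasurableSpace Ω] (μ : Measure Ω)
  (G : Type*) [Group G] [MetricSpace G] [IsTopologicalGroup G]

/-- The orbit space `L(Ω, G)/G` for the action `(g • f)(t) = g * f(t)` of `G` on `L(Ω, G)`. -/
def BSpace : Type _ := MulAction.orbitRel.Quotient G (LSpace μ G)

variable {G}

/-- The projection `L(Ω, G) → L(Ω, G)/G`. -/
def BSpace.mk (f : LSpace μ G) : BSpace μ G := Quotient.mk'' f

variable {μ}

theorem BSpace.mk_surjective : Function.Surjective (BSpace.mk μ (G := G)) :=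
  Quotient.mk''_surjective

theorem BSpace.mk_eq_mk {f₁ f₂ : LSpace μ G} :
    BSpace.mk μ f₁ = BSpace.mk μ f₂ ↔ ∃ g : G, g • f₂ = f₁ :=
  Quotient.eq''

theorem BSpace.mk_smul (g : G) (f : LSpace μ G) : BSpace.mk μ (g • f) = BSpace.mk μ f :=
  BSpace.mk_eq_mk.2 ⟨g, rfl⟩

/-- The quotient topology on `L(Ω, G)/G`, induced by the metric topology of `L(Ω, G)`. -/
instance BSpace.instTopologicalSpace [BoundedSpace G] [IsFiniteMeasure μ] :
    TopologicalSpace (BSpace μ G) :=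
  TopologicalSpace.coinduced (BSpace.mk μ) inferInstance

variable [IsProbabilityMeasure μ] [CompactSpace G]

theorem LSpace.dist_smul_smul [IsIsometricSMul G G] (g : G) (f₁ f₂ : LSpace μ G) :
    dist (g • f₁) (g • f₂) = dist f₁ f₂ := by
  rw [LSpace.dist_def, LSpace.dist_def]
  refine integral_congr_ae ?_
  filter_upwards [AEEqFun.coeFn_smul g f₁, AEEqFun.coeFn_smul g f₂] with t h₁ h₂
  rw [h₁, h₂]
  exact dist_smul g (f₁ t) (f₂ t)

theorem LSpace.dist_smul_left [IsIsometricSMul Gᵐᵒᵖ G] (g h : G) (f : LSpace μ G) :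
    dist (g • f) (h • f) = dist g h := by
  rw [LSpace.dist_def]
  have : ∀ᵐ t ∂μ, dist ((g • f) t) ((h • f) t) = dist g h := by
    filter_upwards [AEEqFun.coeFn_smul g f, AEEqFun.coeFn_smul h f] with t h₁ h₂
    rw [h₁, h₂]
    exact dist_mul_right g h (f t)
  rw [integral_congr_ae this]
  simp

/-- The distance between two orbits is the infimum of the distances of representatives. -/
instance BSpace.instDist : Dist (BSpace μ G) where
  dist x y := sInf {r | ∃ f₁ f₂ : LSpace μ G,
    BSpace.mk μ f₁ = x ∧ BSpace.mk μ f₂ = y ∧ r = dist f₁ f₂}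

theorem BSpace.dist_mk_le (f₁ f₂ : LSpace μ G) :
    dist (BSpace.mk μ f₁) (BSpace.mk μ f₂) ≤ dist f₁ f₂ :=
  csInf_le ⟨0, by rintro _ ⟨_, _, _, _, rfl⟩; exact dist_nonneg⟩ ⟨f₁, f₂, rfl, rfl, rfl⟩

variable [IsIsometricSMul G G] [IsIsometricSMul Gᵐᵒᵖ G]

theorem BSpace.exists_dist_eq (f : LSpace μ G) (y : BSpace μ G) :
    ∃ h : LSpace μ G, BSpace.mk μ h = y ∧ dist (BSpace.mk μ f) y = dist f h := by
  obtain ⟨k, rfl⟩ := BSpace.mk_surjective y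
  have hc : Continuous fun g : G => dist f (g • k) := by
    refine continuous_const.dist (LipschitzWith.continuous (K := 1) ?_)
    exact LipschitzWith.of_dist_le_mul fun g h => by simp [LSpace.dist_smul_left]
  obtain ⟨g, -, hg⟩ := isCompact_univ.exists_isMinOn (Set.univ_nonempty (α := G)) hc.continuousOn
  refine ⟨g • k, BSpace.mk_smul g k, le_antisymm ?_ ?_⟩
  · simpa [BSpace.mk_smul] using BSpace.dist_mk_le f (g • k)
  · refine le_csInf ⟨_, f, k, rfl, rfl, rfl⟩ ?_
    rintro _ ⟨f₁, f₂, h₁, h₂, rfl⟩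
    obtain ⟨a, rfl⟩ := BSpace.mk_eq_mk.1 h₁
    obtain ⟨b, rfl⟩ := BSpace.mk_eq_mk.1 h₂
    calc dist f (g • k) ≤ dist f ((a⁻¹ * b) • k) := hg (Set.mem_univ _)
      _ = dist (a • f) (b • k) := by
        rw [← LSpace.dist_smul_smul a, smul_smul, mul_inv_cancel_left]

/-- The metric space `L(Ω, G)/G`, with the infimum distance; its topology is the quotient one. -/
instance BSpace.instMetricSpace : MetricSpace (BSpace μ G) :=
  letI m : MetricSpace (BSpace μ G) :=
    { dist_self := fun x => by
        obtain ⟨f, rfl⟩ := BSpace.mk_surjective x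
        refine le_antisymm ((BSpace.dist_mk_le f f).trans (dist_self f).le) ?_
        obtain ⟨h, -, hh⟩ := BSpace.exists_dist_eq f (BSpace.mk μ f)
        exact hh ▸ dist_nonneg
      dist_comm := fun x y => by
        refine congrArg sInf (Set.ext fun r => ⟨?_, ?_⟩) <;>
        · rintro ⟨f₁, f₂, h₁, h₂, rfl⟩
          exact ⟨f₂, f₁, h₂, h₁, dist_comm _ _⟩
      dist_triangle := fun x y z => by
        obtain ⟨f, rfl⟩ := BSpace.mk_surjective x
        obtain ⟨h, rfl, hy⟩ := BSpace.exists_dist_eq f y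
        obtain ⟨k, rfl, hz⟩ := BSpace.exists_dist_eq h z
        rw [hy, hz]
        exact (BSpace.dist_mk_le f k).trans (dist_triangle f h k)
      eq_of_dist_eq_zero := fun {x y} hxy => by
        obtain ⟨f, rfl⟩ := BSpace.mk_surjective x
        obtain ⟨h, rfl, hy⟩ := BSpace.exists_dist_eq f y
        rw [dist_eq_zero.1 (hy.symm.trans hxy)] }
  m.replaceTopology <| by
    refine TopologicalSpace.ext_iff.2 fun s => ?_
    change IsOpen (BSpace.mk μ ⁻¹' s) ↔ _
    rw [Metric.isOpen_iff, Metric.isOpen_iff]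
    constructor
    · intro H x hx
      obtain ⟨f, rfl⟩ := BSpace.mk_surjective x
      obtain ⟨ε, hε, hs⟩ := H f hx
      refine ⟨ε, hε, fun y hy => ?_⟩
      obtain ⟨h, rfl, hh⟩ := BSpace.exists_dist_eq f y
      refine hs (Metric.mem_ball'.2 ?_)
      rw [← hh]
      exact Metric.mem_ball'.1 hy
    · intro H f hf
      obtain ⟨ε, hε, hs⟩ := H _ hf
      exact ⟨ε, hε, fun h hh => hs (Metric.mem_ball.2 ((BSpace.dist_mk_le h f).trans_lt hh))⟩

end Orbits

/-- A space `X` is a weak `K(G, 1)` if it is path connected, its fundamental group is isomorphic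
to `G`, and its homotopy groups in degrees `n ≥ 2` are trivial (`X` is not required to have the
homotopy type of a CW complex). -/
structure IsWeakEilenbergMacLaneOne (G : Type*) [Group G] (X : Type*) [TopologicalSpace X] :
    Prop where
  pathConnectedSpace : PathConnectedSpace X
  fundamentalGroup : ∀ x : X, Nonempty (FundamentalGroup X x ≃* G)
  homotopyGroup : ∀ n : ℕ, 2 ≤ n → ∀ x : X, Subsingleton (π_ n X x)

end RandomVariables

end

/-! The space `L(Ω, G)` is contractible: sweep out `Ω` by sublevel sets of a Borel embedding into
the interval, replacing `f` by a fixed `c` on the swept part. Non-atomicity makes this continuous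
(`id_homotopicRel_const`). The action of `G` is free and isometric, but the projection is not a
covering when `G` is infinite. It still lifts maps from simply connected, locally path connected
spaces (`exists_lift`): for each open normal `N` the quotient `L/N → L/G` is a covering, and the
lifts to all `L/N` fit together by compactness. Lifts are unique because `G` is totally disconnected
(`lift_unique`). Lifting loops, homotopies and cubes then gives the homotopy groups as for a
universal covering. -/

namespace RandomVariables

open Set Filter unitInterval

/-! ### Contractibility of `L(Ω, E)` -/

namespace LSpace

variable {Ω : Type*} [MeasurableSpace Ω] {μ : Measure Ω} {E : Type*}

section

variable [TopologicalSpace E]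

open Classical in
/-- The map which equals `f` on `s` and `g` off `s`. -/
noncomputable def piecewise {s : Set Ω} (hs : MeasurableSet s) (f g : LSpace μ E) : LSpace μ E :=
  AEEqFun.mk (s.piecewise f g)
    (f.aestronglyMeasurable.restrict.piecewise hs g.aestronglyMeasurable.restrict)

open Classical in
theorem coeFn_piecewise {s : Set Ω} (hs : MeasurableSet s) (f g : LSpace μ E) :
    piecewise hs f g =ᵐ[μ] s.piecewise f g :=
  AEEqFun.coeFn_mk _ _

end

variable [MetricSpace E] [BoundedSpace E] [IsFiniteMeasure μ]

theorem dist_piecewise_le {s : Set Ω} (hs : MeasurableSet s) (c f g : LSpace μ E) :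
    dist (piecewise hs c f) (piecewise hs c g) ≤ dist f g := by
  classical
  rw [dist_def, dist_def]
  refine integral_mono_ae (integrable_dist _ _) (integrable_dist _ _) ?_
  filter_upwards [coeFn_piecewise hs c f, coeFn_piecewise hs c g] with t h₁ h₂
  rw [h₁, h₂]
  by_cases ht : t ∈ s <;> simp [ht]

variable {φ : Ω → I} (hφ : Measurable φ)

/-- Dominated convergence: whenever `φ t ≠ s₀`, the integrand vanishes for all `s` near `s₀`. -/
theorem continuous_piecewise_le (hφ₀ : ∀ s, ∀ᵐ t ∂μ, φ t ≠ s) (c f : LSpace μ E) :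
    Continuous fun s : I => piecewise (hφ measurableSet_Iic : MeasurableSet (φ ⁻¹' Iic s)) c f := by
  classical
  refine continuous_iff_continuousAt.2 fun s₀ => tendsto_iff_dist_tendsto_zero.2 ?_
  have key : ContinuousAt (fun s : I => ∫ t, dist ((φ ⁻¹' Iic s).piecewise c f t)
      ((φ ⁻¹' Iic s₀).piecewise c f t) ∂μ) s₀ := by
    refine continuousAt_of_dominated (bound := fun _ => Metric.diam (univ : Set E))
      (Eventually.of_forall fun s => ?_)
      (Eventually.of_forall fun s => Eventually.of_forall fun t => ?_) (integrable_const _) ?_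
    · exact (c.aestronglyMeasurable.restrict.piecewise (hφ measurableSet_Iic)
        f.aestronglyMeasurable.restrict).dist (c.aestronglyMeasurable.restrict.piecewise
          (hφ measurableSet_Iic) f.aestronglyMeasurable.restrict)
    · rw [Real.norm_of_nonneg dist_nonneg]
      exact Metric.dist_le_diam_of_mem (Bornology.IsBounded.all _) (mem_univ _) (mem_univ _)
    · filter_upwards [hφ₀ s₀] with t ht
      refine (continuousAt_const (y := (0 : ℝ))).congr ?_
      rcases lt_or_gt_of_ne ht with ht | ht
      · filter_upwards [lt_mem_nhds ht] with s hs
        simp [Set.piecewise, ht.le, hs.le]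
      · filter_upwards [gt_mem_nhds ht] with s hs
        simp [Set.piecewise, ht.not_ge, hs.not_ge]
  have h := key.tendsto
  simp only [dist_self, integral_zero] at h
  refine h.congr fun s => ?_
  rw [dist_def]
  refine integral_congr_ae ?_
  filter_upwards [coeFn_piecewise (hφ measurableSet_Iic : MeasurableSet (φ ⁻¹' Iic s)) c f,
    coeFn_piecewise (hφ measurableSet_Iic : MeasurableSet (φ ⁻¹' Iic s₀)) c f] with t h₁ h₂
  rw [h₁, h₂]

theorem continuous_piecewise_le_uncurry (hφ₀ : ∀ s, ∀ᵐ t ∂μ, φ t ≠ s) (c : LSpace μ E) :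
    Continuous fun x : I × LSpace μ E =>
      piecewise (hφ measurableSet_Iic : MeasurableSet (φ ⁻¹' Iic x.1)) c x.2 :=
  (continuous_prod_of_continuous_lipschitzWith
    (fun x : LSpace μ E × I =>
      piecewise (hφ measurableSet_Iic : MeasurableSet (φ ⁻¹' Iic x.2)) c x.1) 1
    (fun f => continuous_piecewise_le hφ hφ₀ c f)
    (fun s => LipschitzWith.of_dist_le_mul fun f g => by
      simpa using dist_piecewise_le _ c f g)).comp continuous_swap

/-- Over a non-atomic standard Borel space, `L(Ω, E)` strongly deformation retracts to each of its
points. -/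
theorem id_homotopicRel_const [StandardBorelSpace Ω] [NullSingletonClass μ] (c : LSpace μ E) :
    (ContinuousMap.id (LSpace μ E)).HomotopicRel (ContinuousMap.const _ c) {c} := by
  classical
  have he := measurableEmbedding_sigmoid_comp_embeddingReal Ω
  set φ : Ω → I := unitInterval.sigmoid ∘ embeddingReal Ω
  have hφ₀ : ∀ s, ∀ᵐ t ∂μ, φ t ≠ s := fun s => by
    have : μ (φ ⁻¹' {s}) = 0 := (subsingleton_singleton.preimage he.injective).measure_zero μ
    exact measure_eq_zero_iff_ae_notMem.1 this
  refine ⟨⟨⟨⟨_, continuous_piecewise_le_uncurry he.measurable hφ₀ c⟩, fun f => ?_, fun f => ?_⟩,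
    ?_⟩⟩
  -- The set `φ ≤ 0` may be nonempty, but it is null.
  · refine AEEqFun.ext ?_
    filter_upwards [coeFn_piecewise (he.measurable measurableSet_Iic :
      MeasurableSet (φ ⁻¹' Iic 0)) c f, hφ₀ 0] with t h₁ h₂
    refine h₁.trans (piecewise_eq_of_notMem _ _ _ fun h => h₂ (le_antisymm h bot_le))
  · refine AEEqFun.ext ?_
    filter_upwards [coeFn_piecewise (he.measurable measurableSet_Iic :
      MeasurableSet (φ ⁻¹' Iic 1)) c f] with t h₁
    exact h₁.trans (piecewise_eq_of_mem _ _ _ (le_top : φ t ≤ 1))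
  · rintro s f rfl
    refine AEEqFun.ext ?_
    filter_upwards [coeFn_piecewise (he.measurable measurableSet_Iic :
      MeasurableSet (φ ⁻¹' Iic s)) f f] with t h₁
    exact h₁.trans (by simp)

end LSpace
/-- A projection `p : X → B` which presents `B` as the orbit space of an action by isometries of the
metric group `G` on the metric space `X`, each orbit map `g ↦ g • x` being an isometry. -/
structure IsIsometricQuotient (G : Type*) {X B : Type*} [Group G] [MetricSpace G] [MetricSpace X]
    [TopologicalSpace B] [MulAction G X] (p : X → B) : Prop extends IsOpenQuotientMap p where
  apply_eq_iff : ∀ {x y : X}, p x = p y ↔ ∃ g : G, g • y = x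
  dist_smul_smul : ∀ (g : G) (x y : X), dist (g • x) (g • y) = dist x y
  dist_smul_left : ∀ (g h : G) (x : X), dist (g • x) (h • x) = dist g h

/-! ### Lifting to isometric quotients -/

namespace IsIsometricQuotient

variable {G X B : Type*} [Group G] [MetricSpace G] [MetricSpace X]
  [TopologicalSpace B] [MulAction G X] {p : X → B} (hp : IsIsometricQuotient G p)

include hp

theorem map_smul (g : G) (x : X) : p (g • x) = p x := hp.apply_eq_iff.2 ⟨g, rfl⟩

theorem continuous_smul_left (x : X) : Continuous fun g : G => g • x :=
  (Isometry.of_dist_eq fun g h => hp.dist_smul_left g h x).continuous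

theorem smul_left_injective (x : X) : Function.Injective fun g : G => g • x :=
  (Isometry.of_dist_eq fun g h => hp.dist_smul_left g h x).injective

theorem continuous_smul (g : G) : Continuous fun x : X => g • x :=
  (Isometry.of_dist_eq fun x y => hp.dist_smul_smul g x y).continuous

/-- Two lifts of the same map on a connected space agree if they agree at a point. -/
theorem lift_unique [TotallyDisconnectedSpace G] {A : Type*} [TopologicalSpace A]
    [PreconnectedSpace A] {F₁ F₂ : A → X} (h₁ : Continuous F₁) (h₂ : Continuous F₂)
    (h : ∀ a, p (F₁ a) = p (F₂ a)) {a₀ : A} (h₀ : F₁ a₀ = F₂ a₀) (a : A) : F₁ a = F₂ a := by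
  -- The element `g a` carrying `F₂ a` to `F₁ a` depends continuously on `a`, hence is constant.
  choose g hg using fun a => hp.apply_eq_iff.1 (h a)
  have key : ∀ a b, dist (g a) (g b) ≤ dist (F₁ a) (F₁ b) + dist (F₂ a) (F₂ b) := fun a b => by
    calc dist (g a) (g b) = dist (g a • F₂ b) (g b • F₂ b) := (hp.dist_smul_left _ _ _).symm
      _ ≤ dist (g a • F₂ b) (g a • F₂ a) + dist (g a • F₂ a) (g b • F₂ b) := dist_triangle _ _ _
      _ = dist (F₁ a) (F₁ b) + dist (F₂ a) (F₂ b) := by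
        rw [hp.dist_smul_smul, hg, hg, dist_comm (F₂ b), add_comm]
  have hc : Continuous g := continuous_iff_continuousAt.2 fun b => by
    refine tendsto_iff_dist_tendsto_zero.2 (squeeze_zero (fun _ => dist_nonneg)
      (fun a => key a b) ?_)
    simpa using (tendsto_iff_dist_tendsto_zero.1 (h₁.tendsto b)).add
      (tendsto_iff_dist_tendsto_zero.1 (h₂.tendsto b))
  have hconst : g a = g a₀ :=
    (isPreconnected_univ.image g hc.continuousOn).subsingleton ⟨a, trivial, rfl⟩ ⟨a₀, trivial, rfl⟩
  have hone : g a₀ = 1 := hp.smul_left_injective (F₂ a₀) (by simp [hg, h₀])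
  rw [← hg a, hconst, hone, one_smul]

/-- A map to a fibre of the projection is constant on a connected space. -/
theorem eq_of_lift_const [TotallyDisconnectedSpace G] {A : Type*} [TopologicalSpace A]
    [PreconnectedSpace A] {F : A → X} (hF : Continuous F) {b : B} (h : ∀ a, p (F a) = b) (a a' : A) :
    F a = F a' :=
  hp.lift_unique (F₂ := fun _ => F a') hF continuous_const (fun a => (h a).trans (h a').symm) rfl a

omit hp in
/-- The projection `X/N → B` induced by `p : X → B` for a subgroup `N` of `G`. -/
def orbitMap (hp : IsIsometricQuotient G p) (N : Subgroup G) : MulAction.orbitRel.Quotient N X → B :=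
  Quotient.lift p fun _ _ ⟨g, hg⟩ => hp.apply_eq_iff.2 ⟨g.1, hg⟩

omit hp [MetricSpace G] [MetricSpace X] in
theorem mk_eq_mk_iff {N : Subgroup G} {x y : X} :
    (Quotient.mk'' x : MulAction.orbitRel.Quotient N X) = Quotient.mk'' y ↔ ∃ g ∈ N, g • y = x := by
  rw [Quotient.eq'']
  exact ⟨fun ⟨g, hg⟩ => ⟨g.1, g.2, hg⟩, fun ⟨g, hg, h⟩ => ⟨⟨g, hg⟩, h⟩⟩

theorem isOpenQuotientMap_mk (N : Subgroup G) :
    IsOpenQuotientMap (Quotient.mk'' : X → MulAction.orbitRel.Quotient N X) := by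
  have : ContinuousConstSMul N X := ⟨fun g => hp.continuous_smul (g : G)⟩
  exact ⟨Quotient.mk''_surjective, continuous_quotient_mk', isOpenMap_quotient_mk'_mul⟩

theorem isOpenQuotientMap_orbitMap (N : Subgroup G) : IsOpenQuotientMap (hp.orbitMap N) := by
  have hc : Continuous (hp.orbitMap N) := hp.continuous.quotient_lift _
  refine ⟨fun b => ?_, hc, fun U hU => ?_⟩
  · obtain ⟨x, rfl⟩ := hp.surjective b
    exact ⟨Quotient.mk'' x, rfl⟩
  · convert hp.isOpenMap _ (hU.preimage (hp.isOpenQuotientMap_mk N).continuous) using 1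
    ext b
    constructor
    · rintro ⟨y, hy, rfl⟩
      obtain ⟨x, rfl⟩ := Quotient.mk''_surjective y
      exact ⟨x, hy, rfl⟩
    · rintro ⟨x, hx, rfl⟩
      exact ⟨_, hx, rfl⟩

/-- For an open normal subgroup `N` of `G`, the projection `X/N → B` is a covering map. -/
theorem isCoveringMap_orbitMap [IsIsometricSMul G G] (N : Subgroup G) [N.Normal]
    (hN : IsOpen (N : Set G)) : IsCoveringMap (hp.orbitMap N) := by
  obtain ⟨r, hr, hrN⟩ : ∃ r > 0, ∀ a b : G, dist a b < r + r → a⁻¹ * b ∈ N := by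
    obtain ⟨ε, hε, h⟩ := Metric.isOpen_iff.1 hN 1 N.one_mem
    refine ⟨ε / 2, half_pos hε, fun a b hab => h ?_⟩
    rw [Metric.mem_ball', ← dist_smul a, smul_eq_mul, smul_eq_mul, mul_one, mul_inv_cancel_left]
    linarith
  have hq := hp.isOpenQuotientMap_mk N
  have hf := hp.isOpenQuotientMap_orbitMap N
  let : TopologicalSpace (G ⧸ N) := ⊥
  have : DiscreteTopology (G ⧸ N) := ⟨rfl⟩
  suffices ∀ b : B, ∃ t : Bundle.Trivialization (G ⧸ N) (hp.orbitMap N), b ∈ t.baseSet by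
    choose t ht using this
    exact IsCoveringMap.mk _ (fun _ => G ⧸ N) t ht
  intro b
  obtain ⟨x, rfl⟩ := hp.surjective b
  have : Nonempty (B → MulAction.orbitRel.Quotient N X) := ⟨Function.surjInv hf.surjective⟩
  -- The sheet indexed by a coset is the image of the `r`-balls around the points `g • x` with `g`
  -- in that coset.
  let U : G ⧸ N → Set (MulAction.orbitRel.Quotient N X) := fun c =>
    Quotient.mk'' '' {y | ∃ g : G, (g : G ⧸ N) = c ∧ dist (g • x) y < r}
  -- Here `k * g` and `g'` move `x` to points less than `2r` apart, so they lie in one coset of `N`.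
  have key : ∀ {g g' k : G} {y y' : X}, dist (g • x) y < r → dist (g' • x) y' < r → k • y = y' →
      (k * g)⁻¹ * g' ∈ N := by
    rintro g g' k y _ hy hy' rfl
    refine hrN _ _ ?_
    rw [← hp.dist_smul_left _ _ x, mul_smul]
    calc _ ≤ dist (k • g • x) (k • y) + dist (g' • x) (k • y) := dist_triangle_right _ _ _
      _ < r + r := by
        rw [hp.dist_smul_smul]
        exact add_lt_add hy hy'
  have hU : ∀ c, IsOpen (U c) := fun c => hq.isOpenMap _ <| by
    have : {y | ∃ g : G, (g : G ⧸ N) = c ∧ dist (g • x) y < r} =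
        ⋃ g ∈ {g : G | (g : G ⧸ N) = c}, Metric.ball (g • x) r := by
      ext y
      simp [dist_comm]
    rw [this]
    exact isOpen_biUnion fun _ _ => Metric.isOpen_ball
  have hsurj : ∀ c, SurjOn (hp.orbitMap N) (U c) (p '' Metric.ball x r) := by
    rintro c _ ⟨y, hy, rfl⟩
    obtain ⟨g, rfl⟩ := QuotientGroup.mk_surjective c
    refine ⟨_, ⟨g • y, ⟨g, rfl, ?_⟩, rfl⟩, hp.map_smul g y⟩
    rw [hp.dist_smul_smul]
    exact Metric.mem_ball'.1 hy
  refine ⟨IsOpen.trivializationDiscrete U (p '' Metric.ball x r)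
    (hp.isOpenMap _ Metric.isOpen_ball) (fun c W hW => ⟨fun h => (h.preimage hf.continuous).inter
      (hU c), fun h => ?_⟩) ?_ hsurj ?_ ?_, x, Metric.mem_ball_self hr, rfl⟩
  · convert hf.isOpenMap _ h using 1
    refine subset_antisymm (fun w hw => ?_) (image_subset_iff.2 inter_subset_left)
    obtain ⟨y, hy, rfl⟩ := hsurj c (hW hw)
    exact ⟨y, ⟨hw, hy⟩, rfl⟩
  · rintro _ _ ⟨y, ⟨g, rfl, hy⟩, rfl⟩ _ ⟨y', ⟨g', hg', hy'⟩, rfl⟩ h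
    obtain ⟨k, hk⟩ := hp.apply_eq_iff.1 (show p y = p y' from h)
    refine mk_eq_mk_iff.2 ⟨k, ?_, hk⟩
    -- Matching two points of one sheet, `k` fixes the coset of `g'`; normality then puts `k` itself
    -- in `N`.
    have h₁ : (g'⁻¹ * k⁻¹) * g ∈ N := by simpa using key hy' hy hk
    have h₂ : g⁻¹ * g' ∈ N := QuotientGroup.eq.1 hg'.symm
    have h₃ : g'⁻¹ * k⁻¹ * g' ∈ N := by simpa [mul_assoc] using N.mul_mem h₁ h₂
    have h₄ := (Subgroup.Normal.conj_mem ‹N.Normal› _ h₃ g')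
    simpa [mul_assoc] using N.inv_mem h₄
  · intro c c' hc
    refine Set.disjoint_left.2 ?_
    rintro _ ⟨y, ⟨g, rfl, hy⟩, rfl⟩ ⟨y', ⟨g', rfl, hy'⟩, h⟩
    obtain ⟨k, hkN, hk⟩ := mk_eq_mk_iff.1 h
    refine hc (QuotientGroup.eq.2 ?_)
    have h₁ : g⁻¹ * k⁻¹ * g' ∈ N := by simpa using key hy hy' hk
    have h₂ : g⁻¹ * k * g ∈ N := by
      simpa using Subgroup.Normal.conj_mem ‹N.Normal› _ hkN g⁻¹
    simpa [mul_assoc] using N.mul_mem h₂ h₁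
  · intro z hz
    obtain ⟨z, rfl⟩ := Quotient.mk''_surjective z
    obtain ⟨y, hy, h⟩ := hz
    obtain ⟨g, rfl⟩ := hp.apply_eq_iff.1 (show p z = p y from h.symm)
    refine mem_iUnion.2 ⟨g, g • y, ⟨g, rfl, ?_⟩, rfl⟩
    rw [hp.dist_smul_smul]
    exact Metric.mem_ball'.1 hy

/-- If `G` is profinite, then every map from a simply connected, locally path connected space to
the orbit space lifts. -/
theorem exists_lift [IsTopologicalGroup G] [CompactSpace G] [TotallyDisconnectedSpace G]
    [IsIsometricSMul G G] {A : Type*} [TopologicalSpace A] [SimplyConnectedSpace A]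
    [LocallyPathConnectedSpace A] (f : C(A, B)) (a₀ : A) (x₀ : X) (h₀ : p x₀ = f a₀) :
    ∃ F : C(A, X), F a₀ = x₀ ∧ ∀ a, p (F a) = f a := by
  have hcov : ∀ N : OpenNormalSubgroup G, IsCoveringMap (hp.orbitMap (N : Subgroup G)) := fun N =>
    hp.isCoveringMap_orbitMap _ N.isOpen'
  choose F hF₀ hF using fun N => ((hcov N).existsUnique_continuousMap_lifts f a₀
    (Quotient.mk'' x₀) h₀).exists
  have hF : ∀ (N : OpenNormalSubgroup G) a, hp.orbitMap (N : Subgroup G) (F N a) = f a := fun N a => congrFun (hF N) a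
  -- Uniqueness of lifts to `X/N` makes the chosen lifts compatible.
  have hmono : ∀ {M N : OpenNormalSubgroup G}, M ≤ N → ∀ {a : A} {x : X},
      Quotient.mk'' x = F M a → Quotient.mk'' x = F N a := by
    intro M N hMN a x hx
    let q : MulAction.orbitRel.Quotient (M : Subgroup G) X →
        MulAction.orbitRel.Quotient (N : Subgroup G) X :=
      Quotient.lift Quotient.mk'' fun _ _ ⟨g, hg⟩ => mk_eq_mk_iff.2 ⟨g.1, hMN g.2, hg⟩
    have hq : Continuous q := (hp.isOpenQuotientMap_mk _).continuous.quotient_lift _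
    have hcomp : ∀ z, hp.orbitMap (N : Subgroup G) (q z) = hp.orbitMap (M : Subgroup G) z :=
      fun z => Quotient.inductionOn' z fun _ => rfl
    have : q ∘ F M = F N := by
      refine (hcov N).eq_of_comp_eq (hq.comp (F M).continuous) (F N).continuous
        (funext fun b => ?_) a₀ ?_
      · simp only [Function.comp_apply, hcomp, hF]
      · simp only [Function.comp_apply, hF₀]
        rfl
    rw [← this, Function.comp_apply, ← hx]
    rfl
  -- A profinite group has arbitrarily small open normal subgroups, and the orbit maps are
  -- isometries.
  have hsmall : ∀ ε > 0, ∃ N : OpenNormalSubgroup G, ∀ a (x y : X),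
      Quotient.mk'' x = F N a → Quotient.mk'' y = F N a → dist x y < ε := by
    intro ε hε
    obtain ⟨N, hN⟩ := ProfiniteGrp.exist_openNormalSubgroup_sub_open_nhds_of_one
      (Metric.isOpen_ball (x := (1 : G)) (ε := ε)) (Metric.mem_ball_self hε)
    refine ⟨N, fun a x y hx hy => ?_⟩
    obtain ⟨g, hg, rfl⟩ := mk_eq_mk_iff.1 (hx.trans hy.symm)
    have := hp.dist_smul_left g 1 y
    rw [one_smul] at this
    rw [this]
    exact Metric.mem_ball.1 (hN hg)
  -- The orbits `F N a` form a directed family of nonempty compact sets, so they share a point.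
  have hne : ∀ a, (⋂ N, {x : X | Quotient.mk'' x = F N a}).Nonempty := by
    intro a
    have hcpt : ∀ N, IsCompact {x : X | Quotient.mk'' x = F N a} := by
      intro N
      obtain ⟨y, hy⟩ := Quotient.mk''_surjective (F N a)
      have hc : IsCompact (N : Set G) := N.toOpenSubgroup.isClosed.isCompact
      convert hc.image (hp.continuous_smul_left y) using 1
      ext x
      rw [mem_ofPred_eq, ← hy, mk_eq_mk_iff]
      rfl
    have : Nonempty (OpenNormalSubgroup G) := ⟨(hsmall 1 one_pos).choose⟩
    exact IsCompact.nonempty_iInter_of_directed_nonempty_isCompact_isClosed _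
      (fun M N => ⟨M ⊓ N, fun x hx => hmono inf_le_left hx, fun x hx => hmono inf_le_right hx⟩)
      (fun N => Quotient.mk''_surjective _) hcpt (fun N => (hcpt N).isClosed)
  choose Φ hΦ using hne
  have hΦ : ∀ N a, Quotient.mk'' (Φ a) = F N a := fun N a => mem_iInter.1 (hΦ a) N
  refine ⟨⟨Φ, Metric.continuous_iff'.2 fun a ε hε => ?_⟩, ?_, fun a => ?_⟩
  -- For `b` near `a`, the small orbit `F N b` contains both `Φ b` and a point near `Φ a`.
  · obtain ⟨N, hN⟩ := hsmall (ε / 2) (half_pos hε)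
    have hopen := (hp.isOpenQuotientMap_mk (N : Subgroup G)).isOpenMap _
      (Metric.isOpen_ball (x := Φ a) (ε := ε / 2))
    filter_upwards [(F N).continuous.continuousAt.preimage_mem_nhds
      (hopen.mem_nhds ⟨Φ a, Metric.mem_ball_self (half_pos hε), hΦ N a⟩)] with b hb
    obtain ⟨y, hy, hyb⟩ := hb
    calc dist (Φ b) (Φ a) ≤ dist (Φ b) y + dist y (Φ a) := dist_triangle _ _ _
      _ < ε / 2 + ε / 2 := add_lt_add (hN b _ _ (hΦ N b) hyb) hy
      _ = ε := add_halves ε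
  · refine eq_of_forall_dist_le fun ε hε => ?_
    obtain ⟨N, hN⟩ := hsmall ε hε
    exact (hN a₀ _ _ (hΦ N a₀) (hF₀ N).symm).le
  · obtain ⟨N, -⟩ := hsmall 1 one_pos
    rw [← hF N a, ← hΦ N a]
    rfl

end IsIsometricQuotient

instance contractibleSpace_unitInterval : ContractibleSpace I :=
  (convex_Icc (0 : ℝ) 1).contractibleSpace ⟨0, by simp⟩

instance locallyPathConnectedSpace_unitInterval : LocallyPathConnectedSpace I :=
  (convex_Icc (0 : ℝ) 1).locallyPathConnectedSpace

instance contractibleSpace_cube (N : Type*) : ContractibleSpace (N → I) := by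
  refine (contractible_iff_id_nullhomotopic _).2 ⟨0, ⟨⟨⟨fun x i => σ x.1 * x.2 i, by fun_prop⟩,
    fun y => ?_, fun y => ?_⟩⟩⟩ <;> ext i <;> simp

/-! ### Homotopy groups of the quotient -/

namespace IsIsometricQuotient

variable {G X B : Type*} [Group G] [MetricSpace G] [MetricSpace X]
  [TopologicalSpace B] [MulAction G X] {p : X → B} (hp : IsIsometricQuotient G p)
  [IsTopologicalGroup G] [CompactSpace G] [TotallyDisconnectedSpace G] [IsIsometricSMul G G]

include hp

/-- If `X` strongly deformation retracts to its points, then the higher homotopy groups of the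
orbit space vanish. -/
theorem subsingleton_homotopyGroup {N : Type*} [Nontrivial N]
    (hX : ∀ x : X, (ContinuousMap.id X).HomotopicRel (ContinuousMap.const X x) {x}) (b : B) :
    Subsingleton (HomotopyGroup N B b) := by
  classical
  obtain ⟨x, rfl⟩ := hp.surjective b
  suffices ∀ γ : GenLoop N B (p x), GenLoop.Homotopic γ GenLoop.const by
    refine ⟨fun a b => ?_⟩
    induction a using Quotient.inductionOn
    induction b using Quotient.inductionOn
    exact Quotient.sound ((this _).trans (this _).symm)
  intro γ
  have hz : ∀ {y : N → I} {j : N}, y j = 0 → y ∈ Cube.boundary N := fun h => ⟨_, Or.inl h⟩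
  obtain ⟨j₀⟩ : Nonempty N := inferInstance
  obtain ⟨F, hF₀, hF⟩ := hp.exists_lift γ.1 0 x (γ.2 0 (hz (j := j₀) rfl)).symm
  have hF : ∀ y, p (F y) = γ y := hF
  -- Scaling `y` to the origin stays in the face, where the lift runs in a single fibre.
  have hface : ∀ (j : N) (y : N → I), y j = 0 → F y = x := by
    intro j y hy
    have := hp.eq_of_lift_const (F := fun s : I => F fun i => s * y i) (b := p x) (by fun_prop)
      (fun s => (hF _).trans (γ.2 _ (hz (j := j) (by simp [hy])))) 1 0
    simpa [← hF₀, Pi.zero_def] using this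
  -- On any face, a second coordinate `j ≠ i` can be moved to `0` within the boundary; this is where
  -- dimension at least two enters.
  have hbdry : ∀ y ∈ Cube.boundary N, F y = x := by
    rintro y ⟨i, hi⟩
    obtain ⟨j, hj⟩ := exists_ne i
    have := hp.eq_of_lift_const (F := fun s : I => F (Function.update y j s)) (b := p x)
      (by fun_prop) (fun s => (hF _).trans (γ.2 _ ⟨i, by simpa [hj.symm] using hi⟩)) (y j) 0
    rw [Function.update_eq_self] at this
    rw [this]
    exact hface j _ (by simp)
  -- As `H` fixes `x`, the projected homotopy is constant on the boundary.
  obtain ⟨H⟩ := hX x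
  refine ⟨⟨⟨⟨fun z => p (H (z.1, F z.2)), hp.continuous.comp (by fun_prop)⟩, fun y => ?_,
    fun y => ?_⟩, fun s y hy => ?_⟩⟩
  · simpa using hF y
  · simp
  · have := H.eq_fst s (x := F y) (hbdry y hy)
    simpa [hF y] using congrArg p this

/-- The loop in the orbit space which is the image of a path from `x` to `g • x`. -/
noncomputable def loop [SimplyConnectedSpace X] (hp : IsIsometricQuotient G p) (x : X) (g : G) :
    FundamentalGroup B (p x) :=
  FundamentalGroup.fromPath (.mk (((PathConnectedSpace.somePath x (g • x)).map hp.continuous).cast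
    rfl (hp.map_smul g x).symm))

variable [SimplyConnectedSpace X]

omit [IsTopologicalGroup G] [CompactSpace G] [TotallyDisconnectedSpace G] [IsIsometricSMul G G] in
theorem loop_eq (x : X) (g : G) (Γ : Path x (g • x)) :
    hp.loop x g =
      .mk ((Γ.map hp.continuous).cast rfl (hp.map_smul g x).symm) := by
  refine Quotient.sound ?_
  exact ((SimplyConnectedSpace.paths_homotopic _ Γ).map ⟨p, hp.continuous⟩).pathCast _ _

-- A path to `g • x` followed by the `g`-translate of a path to `h • x` ends at `(g * h) • x`. The
-- order reverses because the product in `FundamentalGroup` traverses its right factor first.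
omit [IsTopologicalGroup G] [CompactSpace G] [TotallyDisconnectedSpace G] [IsIsometricSMul G G] in
theorem loop_mul (x : X) (g h : G) : hp.loop x (g * h) = hp.loop x h * hp.loop x g := by
  let Γ := PathConnectedSpace.somePath x (g • x)
  let Δ := PathConnectedSpace.somePath x (h • x)
  rw [hp.loop_eq x (g * h) ((Γ.trans (Δ.map (hp.continuous_smul g))).cast rfl (mul_smul g h x)),
    hp.loop_eq x g Γ, hp.loop_eq x h Δ, FundamentalGroup.mul_def]
  refine (congrArg _ ?_).trans (Path.Homotopic.Quotient.mk_trans _ _)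
  ext t
  simp only [Path.cast_coe, Path.map_coe, Function.comp_apply, Path.trans_apply]
  split_ifs
  · rfl
  · exact hp.map_smul _ _

theorem loop_surjective (x : X) : Function.Surjective (hp.loop x) := by
  intro γ
  obtain ⟨γ, rfl⟩ := Path.Homotopic.Quotient.mk_surjective γ
  obtain ⟨F, hF₀, hF⟩ := hp.exists_lift γ.toContinuousMap 0 x γ.source.symm
  have hF : ∀ t, p (F t) = γ t := hF
  obtain ⟨g, hg⟩ := hp.apply_eq_iff.1 ((hF 1).trans γ.target)
  refine ⟨g, (hp.loop_eq x g ⟨F, hF₀, hg.symm⟩).trans (congrArg _ ?_)⟩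
  ext t
  exact hF t

/-- In the lifted homotopy the sides `t = 0` and `t = 1` lie in a fibre, so they are constant and
the endpoints `g • x` and `h • x` coincide. -/
theorem loop_injective (x : X) : Function.Injective (hp.loop x) := by
  intro g h hgh
  obtain ⟨H⟩ := Path.Homotopic.Quotient.exact hgh
  set Γ := PathConnectedSpace.somePath x (g • x)
  set Δ := PathConnectedSpace.somePath x (h • x)
  obtain ⟨F, hF₀, hF⟩ := hp.exists_lift ⟨H, H.continuous⟩ (0, 0) x (by simp)
  have hF : ∀ s t, p (F (s, t)) = H (s, t) := fun s t => hF (s, t)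
  have hleft : ∀ s, F (s, 0) = x := fun s => by
    rw [← hF₀]
    exact hp.eq_of_lift_const (F := fun s : I => F (s, 0)) (b := p x) (by fun_prop)
      (fun s => by simp [hF]) s 0
  have hbottom : F (0, 1) = Γ 1 :=
    hp.lift_unique (F₁ := fun t : I => F (0, t)) (F₂ := Γ) (a₀ := 0) (by fun_prop) Γ.continuous
      (fun t => (hF 0 t).trans (by simp [Γ])) ((hleft 0).trans Γ.source.symm) 1
  have htop : F (1, 1) = Δ 1 :=
    hp.lift_unique (F₁ := fun t : I => F (1, t)) (F₂ := Δ) (a₀ := 0) (by fun_prop) Δ.continuous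
      (fun t => (hF 1 t).trans (by simp [Δ])) ((hleft 1).trans Δ.source.symm) 1
  have hright : F (0, 1) = F (1, 1) :=
    hp.eq_of_lift_const (F := fun s : I => F (s, 1)) (b := p x) (by fun_prop)
      (fun s => by simp [hF]) 0 1
  rw [hbottom, htop, Γ.target, Δ.target] at hright
  exact hp.smul_left_injective x hright

/-- The fundamental group of the quotient of a simply connected space by a profinite group. -/
noncomputable def fundamentalGroupEquiv (hp : IsIsometricQuotient G p) (x : X) :
    G ≃* FundamentalGroup B (p x) :=
  MulEquiv.ofBijective
    -- The inverse turns the anti-homomorphism `loop` into a homomorphism.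
    (MonoidHom.mk' (fun g => hp.loop x g⁻¹) fun g h => by rw [mul_inv_rev, hp.loop_mul])
    ((show Function.Bijective (hp.loop x) from ⟨hp.loop_injective x, hp.loop_surjective x⟩).comp
      (Equiv.inv G).bijective)

end IsIsometricQuotient

theorem BSpace.isIsometricQuotient_mk {Ω : Type*} [MeasurableSpace Ω] (μ : Measure Ω)
    [IsProbabilityMeasure μ] (G : Type*) [Group G] [MetricSpace G] [IsTopologicalGroup G]
    [CompactSpace G] [IsIsometricSMul G G] [IsIsometricSMul Gᵐᵒᵖ G] :
    IsIsometricQuotient G (BSpace.mk μ : LSpace μ G → BSpace μ G) where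
  surjective := BSpace.mk_surjective
  continuous := continuous_coinduced_rng
  isOpenMap := by
    have : ContinuousConstSMul G (LSpace μ G) :=
      ⟨fun g => (Isometry.of_dist_eq (LSpace.dist_smul_smul g)).continuous⟩
    exact isOpenMap_quotient_mk'_mul
  apply_eq_iff := BSpace.mk_eq_mk
  dist_smul_smul := LSpace.dist_smul_smul
  dist_smul_left := LSpace.dist_smul_left

end RandomVariables

theorem mainTheorem7 {G : Type*} [Group G] [MetricSpace G] [IsTopologicalGroup G]
    [CompactSpace G] [TotallyDisconnectedSpace G]
    [IsIsometricSMul G G] [IsIsometricSMul Gᵐᵒᵖ G]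
    {Ω : Type*} [MeasurableSpace Ω] [StandardBorelSpace Ω]
    (μ : Measure Ω) [IsProbabilityMeasure μ] [NullSingletonClass μ] :
    RandomVariables.IsWeakEilenbergMacLaneOne G (RandomVariables.BSpace μ G) := by
  have hp := RandomVariables.BSpace.isIsometricQuotient_mk μ G
  have hX := RandomVariables.LSpace.id_homotopicRel_const (μ := μ) (E := G)
  have : ContractibleSpace (RandomVariables.LSpace μ G) :=
    (contractible_iff_id_nullhomotopic _).2 ⟨1, (hX 1).homotopic⟩
  refine ⟨hp.surjective.pathConnectedSpace hp.continuous, fun b => ?_, fun n hn b => ?_⟩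
  · obtain ⟨x, rfl⟩ := hp.surjective b
    exact ⟨(hp.fundamentalGroupEquiv x).symm⟩
  · have : Nontrivial (Fin n) := Fin.nontrivial_iff_two_le.2 hn
    exact hp.subsingleton_homotopyGroup hX b
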